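/- A separable permutation is a permutation that can be built from the permutation $1$ by repeatedly applying the direct sum $\oplus$ and the skew sum $\ominus$ (so it has length at least $1$). A permutation $\pi_1\cdots\pi_n$, $n\ge 1$, is reducible if for some $2\le i\le n$ every element of $\pi_1\cdots\pi_{i-1}$ is less than every element of $\pi_i\cdots\pi_n$, and irreducible otherwise (in particular the permutation $1$ is irreducible). Let $\mathrm{lmax}$, $\mathrm{rmax}$, $\mathrm{lmin}$, $\mathrm{rmin}$ denote the numbers of left-to-right maxima, right-to-left maxima, left-to-right minima and right-to-left minima of a permutation. For every statistic $\mathrm{stat}\in\{\mathrm{lmax},\mathrm{rmax},\mathrm{lmin},\mathrm{rmin}\}$, the generating function $S(t,z)=\sum_{\pi}t^{|\pi|}z^{\mathrm{stat}(\pi)}$, where the sum is over all separable permutations $\pi$ and $|\pi|$ is the length of $\pi$, is $$S(t,z)=\frac{4\sqrt{\left(-\frac14\sqrt{t^2-6t+1}-tz+\frac t4+\frac54\right)^2+\sqrt{t^2-6t+1}-t-1}-\sqrt{t^2-6t+1}+4tz+t-3}{2\left(\sqrt{t^2-6t+1}-t-1\right)},$$ as formal power series in $t$ over $\mathbb{Q}[z]$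 (both square roots are the ones with constant term $1$). Let $I(t,z)$ and $R(t,z)$ be the generating functions obtained by restricting the sum to the irreducible and to the reducible separable permutations, respectively. If $\mathrm{stat}\in\{\mathrm{rmax},\mathrm{lmin}\}$, then $$I(t,z)=\frac{S^2(t,z)}{1+S(t,z)}+zt,\qquad R(t,z)=\frac{S(t,z)}{1+S(t,z)}-zt.$$ If $\mathrm{stat}\in\{\mathrm{lmax},\mathrm{rmin}\}$, then $$I(t,z)=\left(\frac{S(t,z)}{1+S(t,z)}-zt\right)+zt=\frac{S(t,z)}{1+S(t,z)},\qquad R(t,z)=\left(\frac{S^2(t,z)}{1+S(t,z)}+zt\right)-zt=\frac{S^2(t,z)}{1+S(t,z)}.$$ -/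

import Mathlib

noncomputable section

namespace SepPerm

/-! A permutation of length `n` is written in one-line notation, as a rearrangement of the
word `12⋯n`, i.e. as a list of natural numbers that is a permutation of `[1, 2, …, n]`. -/

/-- The finite set `S_n` of all permutations of length `n`, in one-line notation. -/
def perms (n : ℕ) : Finset (List ℕ) := (List.range' 1 n).permutations.toFinset

/-- `perms n` consists exactly of the rearrangements of `12⋯n`. -/
theorem mem_perms {n : ℕ} {w : List ℕ} : w ∈ perms n ↔ w.Perm (List.range' 1 n) := by
  simp [perms, List.mem_permutations]

/-- The direct sum `π ⊕ σ`. -/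
def directSum (p s : List ℕ) : List ℕ := p ++ s.map (fun a => a + p.length)

/-- The skew sum `π ⊖ σ`. -/
def skewSum (p s : List ℕ) : List ℕ := p.map (fun a => a + s.length) ++ s

/-- Separable permutations: those that can be built from the permutation `1` by repeatedly
applying `⊕` and `⊖`. In particular the empty permutation is not separable. -/
inductive Separable : List ℕ → Prop
  | one : Separable [1]
  | sum {p s : List ℕ} : Separable p → Separable s → Separable (directSum p s)
  | skew {p s : List ℕ} : Separable p → Separable s → Separable (skewSum p s)

/-- A permutation is reducible if it can be cut into two nonempty consecutive parts such that
every element of the first part is less than every element of the second part. -/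
def Reducible (w : List ℕ) : Prop :=
  ∃ u v : List ℕ, u ≠ [] ∧ v ≠ [] ∧ w = u ++ v ∧ ∀ a ∈ u, ∀ b ∈ v, a < b

/-- A nonempty permutation is irreducible if it is not reducible; the empty permutation is
neither reducible nor irreducible. -/
def Irreducible (w : List ℕ) : Prop := w ≠ [] ∧ ¬ Reducible w

/-- The number of left-to-right maxima. -/
def lmax (w : List ℕ) : ℕ :=
  (Finset.univ.filter fun i : Fin w.length => ∀ j : Fin w.length, j < i → w[j] < w[i]).card

/-- The number of right-to-left maxima. -/
def rmax (w : List ℕ) : ℕ :=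
  (Finset.univ.filter fun i : Fin w.length => ∀ j : Fin w.length, i < j → w[j] < w[i]).card

/-- The number of left-to-right minima. -/
def lmin (w : List ℕ) : ℕ :=
  (Finset.univ.filter fun i : Fin w.length => ∀ j : Fin w.length, j < i → w[i] < w[j]).card

/-- The number of right-to-left minima. -/
def rmin (w : List ℕ) : ℕ :=
  (Finset.univ.filter fun i : Fin w.length => ∀ j : Fin w.length, i < j → w[i] < w[j]).card

/-- The ring `ℚ[z]⟦t⟧` of formal power series in `t` over the polynomials in `z`. -/
abbrev Ser : Type := PowerSeries (Polynomial ℚ)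

/-- The variable `t`. -/
def tVar : Ser := PowerSeries.X

/-- The variable `z`. -/
def zVar : Ser := PowerSeries.C Polynomial.X

open scoped Classical in
/-- The generating function `∑ t^{|π|} z^{stat(π)}`, the sum being over all permutations `π`
with the property `P`. -/
def genFun (P : List ℕ → Prop) (stat : List ℕ → ℕ) : Ser :=
  PowerSeries.mk fun n => ∑ w ∈ (perms n).filter P, (Polynomial.X : Polynomial ℚ) ^ stat w

/-- The square root `√f = ∑ₖ (1/2 choose k) (f - 1)ᵏ` of a power series `f` with constant
term `1`. -/
def sqrtSer (f : Ser) : Ser :=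
  (PowerSeries.binomialSeries (Polynomial ℚ) (1 / 2 : ℚ)).subst (f - 1)

theorem hasSubst_sub_one {f : Ser} (hf : PowerSeries.constantCoeff f = 1) :
    PowerSeries.HasSubst (f - 1) :=
  PowerSeries.HasSubst.of_constantCoeff_zero' (by simp [hf])

/-- If `f` has constant term `1`, then `√f` squares to `f`. -/
theorem sqrtSer_sq {f : Ser} (hf : PowerSeries.constantCoeff f = 1) : sqrtSer f ^ 2 = f := by
  have h := hasSubst_sub_one hf
  have h1 : (PowerSeries.binomialSeries (Polynomial ℚ) (1 / 2 : ℚ)) ^ 2 = 1 + PowerSeries.X := by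
    rw [sq, ← PowerSeries.binomialSeries_add]
    have := PowerSeries.binomialSeries_nat (R := ℚ) (A := Polynomial ℚ) 1
    norm_num at this ⊢
    exact this
  rw [sqrtSer, ← PowerSeries.subst_pow h, h1, PowerSeries.subst_add h, PowerSeries.subst_X h]
  have : PowerSeries.subst (f - 1) (1 : Ser) = 1 := by
    rw [← PowerSeries.coe_substAlgHom h, map_one]
  rw [this]; ring

/-- If `f` has constant term `1`, then so has `√f`. -/
theorem constantCoeff_sqrtSer {f : Ser} (hf : PowerSeries.constantCoeff f = 1) :
    PowerSeries.constantCoeff (sqrtSer f) = 1 := by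
  have h := hasSubst_sub_one hf
  have h1 : sqrtSer f = 1 + PowerSeries.subst (f - 1)
      (PowerSeries.binomialSeries (Polynomial ℚ) (1 / 2 : ℚ) - 1) := by
    rw [sqrtSer, ← PowerSeries.coe_substAlgHom h, map_sub, map_one]; ring
  have h2 := PowerSeries.constantCoeff_subst_eq_zero (a := f - 1)
    (show PowerSeries.constantCoeff (f - 1) = 0 by simp [hf])
    (PowerSeries.binomialSeries (Polynomial ℚ) (1 / 2 : ℚ) - 1)
    (by rw [map_sub, PowerSeries.binomialSeries_constantCoeff, map_one, sub_self])
  have h3 : PowerSeries.constantCoeff (PowerSeries.subst (f - 1)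
      (PowerSeries.binomialSeries (Polynomial ℚ) (1 / 2 : ℚ) - 1) : Ser) = 0 := h2
  rw [h1, map_add, h3, map_one, add_zero]

/-- The inner root `√(t² - 6t + 1)`. -/
def innerRoot : Ser := sqrtSer (tVar ^ 2 - 6 * tVar + 1)

/-- The outer root `√((-¼√(t² - 6t + 1) - tz + t/4 + 5/4)² + √(t² - 6t + 1) - t - 1)`. -/
def outerRoot : Ser :=
  sqrtSer ((-(1 / 4 : ℚ) • innerRoot - tVar * zVar + (1 / 4 : ℚ) • tVar + (5 / 4 : ℚ) • 1) ^ 2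
    + innerRoot - tVar - 1)

/-- Both radicands have constant term `1`, so that the two roots are genuine square roots. -/
theorem innerRoot_spec : innerRoot ^ 2 = tVar ^ 2 - 6 * tVar + 1 ∧
    PowerSeries.constantCoeff innerRoot = 1 := by
  have h : PowerSeries.constantCoeff (tVar ^ 2 - 6 * tVar + 1) = 1 := by simp [tVar]
  exact ⟨sqrtSer_sq h, constantCoeff_sqrtSer h⟩

theorem outerRoot_spec :
    outerRoot ^ 2 =
      (-(1 / 4 : ℚ) • innerRoot - tVar * zVar + (1 / 4 : ℚ) • tVar + (5 / 4 : ℚ) • 1) ^ 2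
        + innerRoot - tVar - 1 ∧
    PowerSeries.constantCoeff outerRoot = 1 := by
  have h : PowerSeries.constantCoeff
      ((-(1 / 4 : ℚ) • innerRoot - tVar * zVar + (1 / 4 : ℚ) • tVar + (5 / 4 : ℚ) • 1) ^ 2
        + innerRoot - tVar - 1 : Ser) = 1 := by
    have hs (c : ℚ) (g : Ser) : PowerSeries.constantCoeff (c • g)
        = c • PowerSeries.constantCoeff g := by
      rw [← PowerSeries.coeff_zero_eq_constantCoeff_apply,
        ← PowerSeries.coeff_zero_eq_constantCoeff_apply]
      rfl
    simp only [map_sub, map_add, map_pow, map_mul, hs, innerRoot_spec.2, map_one]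
    simp only [tVar, PowerSeries.constantCoeff_X, smul_zero, zero_mul]
    rw [sub_zero, add_zero, sub_zero, ← add_smul]
    norm_num
  exact ⟨sqrtSer_sq h, constantCoeff_sqrtSer h⟩

/-- The field of fractions of `ℚ[z]⟦t⟧`, in which quotients of power series are formed. -/
abbrev Frac : Type := FractionRing Ser

/-- The embedding of `ℚ[z]⟦t⟧` in its field of fractions. -/
abbrev toFrac : Ser →+* Frac := algebraMap Ser Frac

end SepPerm

end

open SepPerm

namespace SepPerm

/-! ### Separable permutations and reversal -/

/-! A reducible separable permutation is uniquely `p ⊕ s` with `p` irreducible separable and `s`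
separable. Reversal exchanges `⊕` and `⊖`, so the irreducible separable permutations other than `1`
are exactly the reversals of the reducible ones.

For `lmax` and `rmin`, which add over `⊕`, cutting gives `R = I S`; with `S = I + R` this is `I (1 +
S) = S`. On `⊖` these statistics see only one summand, so the other one is counted by length alone.
Hence `I = zt + A S`, where `A` (`irrSer`) counts irreducible separable permutations by length
(`SumAdditive.reducible_reverse`, `SumAdditive.irreducible`).

Eliminating `I` leaves `A S² + (A + zt - 1) S + zt = 0`, with discriminant `(1 + A - zt)² - 4A`. The
same decompositions without a statistic give a quadratic of discriminant `t² - 6t + 1` and `A = (1 +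
t - innerRoot) / 4`. Constant terms select the branch of each root, which yields the closed form for
`S`.

Finally `rmax` and `lmin` are `lmax` and `rmin` of the reversal: `S` is unchanged, while reducible
and irreducible permutations trade places except for `1`. -/

theorem Separable.perm {w : List ℕ} (h : Separable w) : w.Perm (List.range' 1 w.length) := by
  induction h with
  | one => decide
  | @sum p s _ _ hp hs =>
    have h2 := hs.map (fun a => a + p.length)
    have h3 : (List.range' 1 s.length).map (fun a => a + p.length)
        = List.range' (1 + p.length) s.length := by
      simp only [Nat.add_comm _ p.length]
      rw [List.map_add_range']
    rw [h3] at h2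
    have h4 := hp.append h2
    rw [List.range'_append_1] at h4
    simpa [directSum] using h4
  | @skew p s _ _ hp hs =>
    have h2 := hp.map (fun a => a + s.length)
    have h3 : (List.range' 1 p.length).map (fun a => a + s.length)
        = List.range' (1 + s.length) p.length := by
      simp only [Nat.add_comm _ s.length]
      rw [List.map_add_range']
    rw [h3] at h2
    have h4 := (List.perm_append_comm.trans (hs.append h2))
    rw [List.range'_append_1] at h4
    simpa [skewSum, Nat.add_comm] using h4

theorem Separable.mem_bounds {w : List ℕ} (h : Separable w) {a : ℕ} (ha : a ∈ w) :
    1 ≤ a ∧ a ≤ w.length := by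
  have := h.perm.mem_iff.1 ha
  rw [List.mem_range'_1] at this
  omega

theorem Separable.ne_nil {w : List ℕ} (h : Separable w) : w ≠ [] := by
  induction h with
  | one => simp
  | sum _ _ hp _ => simp [directSum, hp]
  | skew _ _ hp _ => simp [skewSum, hp]

theorem reverse_directSum (p s : List ℕ) :
    (directSum p s).reverse = skewSum s.reverse p.reverse := by
  simp [directSum, skewSum, List.map_reverse]

theorem reverse_skewSum (p s : List ℕ) :
    (skewSum p s).reverse = directSum s.reverse p.reverse := by
  simp [directSum, skewSum, List.map_reverse]

theorem Separable.reverse {w : List ℕ} (h : Separable w) : Separable w.reverse := by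
  induction h with
  | one => exact Separable.one
  | sum _ _ hp hs => rw [reverse_directSum]; exact hs.skew hp
  | skew _ _ hp hs => rw [reverse_skewSum]; exact hs.sum hp

theorem separable_reverse_iff {w : List ℕ} : Separable w.reverse ↔ Separable w :=
  ⟨fun h => by simpa using h.reverse, Separable.reverse⟩

/-! ### Decomposition of reducible separable permutations -/

theorem reducible_directSum {p s : List ℕ} (hp : Separable p) (hs : Separable s) :
    Reducible (directSum p s) := by
  refine ⟨p, s.map (fun a => a + p.length), hp.ne_nil, by simpa using hs.ne_nil, rfl, ?_⟩
  intro a ha b hb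
  obtain ⟨c, hc, rfl⟩ := List.mem_map.1 hb
  have := hp.mem_bounds ha
  have := hs.mem_bounds hc
  omega

/-- The first entry of a skew sum exceeds its last entry, and any cut would put the first in the
lower part and the last in the upper part. -/
theorem not_reducible_skewSum {p s : List ℕ} (hp : Separable p) (hs : Separable s) :
    ¬ Reducible (skewSum p s) := by
  rintro ⟨u, v, hu, hv, h, huv⟩
  obtain ⟨a, p', rfl⟩ := List.exists_cons_of_ne_nil hp.ne_nil
  obtain ⟨c, u', rfl⟩ := List.exists_cons_of_ne_nil hu
  rcases List.eq_nil_or_concat s with rfl | ⟨s', b, rfl⟩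
  · exact hs.ne_nil rfl
  rcases List.eq_nil_or_concat v with rfl | ⟨v', d, rfl⟩
  · exact hv rfl
  have h1 := congrArg List.head? h
  have h2 := congrArg List.getLast? h
  simp [skewSum] at h1
  simp only [skewSum, List.concat_eq_append, ← List.append_assoc, List.getLast?_concat,
    Option.some_inj] at h2
  have ha := hp.mem_bounds (a := a) (by simp)
  have hb := hs.mem_bounds (a := b) (by simp)
  have := huv c (by simp) d (by simp)
  simp only [List.length_concat] at hb
  omega

theorem not_reducible_singleton (a : ℕ) : ¬ Reducible [a] := by
  rintro ⟨u, v, hu, hv, h, -⟩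
  have := congrArg List.length h
  have := List.length_pos_iff.2 hu
  have := List.length_pos_iff.2 hv
  simp at *
  omega

theorem directSum_assoc (p q s : List ℕ) :
    directSum (directSum p q) s = directSum p (directSum q s) := by
  simp [directSum, Nat.add_comm q.length]

theorem Separable.exists_irreducible_directSum {w : List ℕ} (h : Separable w)
    (hr : Reducible w) : ∃ p s, Separable p ∧ Irreducible p ∧ Separable s ∧
      directSum p s = w := by
  induction h with
  | one => exact absurd hr (not_reducible_singleton 1)
  | skew hp hs => exact absurd hr (not_reducible_skewSum hp hs)
  | @sum p s hp hs ihp _ =>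
    by_cases hpr : Reducible p
    -- Only the left summand needs splitting further; associativity moves its remainder into the
    -- right summand.
    · obtain ⟨p₁, p₂, h1, h2, h3, rfl⟩ := ihp hpr
      exact ⟨p₁, directSum p₂ s, h1, h2, h3.sum hs, (directSum_assoc _ _ _).symm⟩
    · exact ⟨p, s, hp, ⟨hp.ne_nil, hpr⟩, hs, rfl⟩

theorem directSum_injective_right (p : List ℕ) {s s' : List ℕ}
    (h : directSum p s = directSum p s') : s = s' :=
  List.map_injective_iff.2 (add_left_injective p.length) (List.append_cancel_left h)

/-- If `p'` were longer, it would be `p` followed by entries of the shifted `s`, all larger than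
those of `p`, so it could be cut there. Applied in both directions, this gives uniqueness of the
decomposition. -/
theorem length_le_of_directSum_eq {p s p' s' : List ℕ} (hp : Separable p) (hs : Separable s)
    (hi : ¬ Reducible p') (h : directSum p s = directSum p' s') : p'.length ≤ p.length := by
  by_contra! hlt
  apply hi
  obtain ⟨c, hc⟩ : p <+: p' :=
    List.prefix_of_prefix_length_le (l₃ := directSum p s) ⟨_, rfl⟩ ⟨_, h.symm⟩ hlt.le
  subst hc
  rw [directSum, directSum, List.append_assoc, List.append_cancel_left_eq] at h
  refine ⟨p, c, hp.ne_nil, ?_, rfl, ?_⟩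
  · rintro rfl
    simp at hlt
  · intro a ha b hb
    have hb' : b ∈ s.map (fun a => a + p.length) := by rw [h]; simp [hb]
    obtain ⟨d, hd, rfl⟩ := List.mem_map.1 hb'
    have := hp.mem_bounds ha
    have := hs.mem_bounds hd
    omega

theorem directSum_inj_of_irreducible {p s p' s' : List ℕ} (hp : Separable p) (hs : Separable s)
    (hp' : Separable p') (hs' : Separable s') (hi : ¬ Reducible p) (hi' : ¬ Reducible p')
    (h : directSum p s = directSum p' s') : p = p' ∧ s = s' := by
  have hlen := le_antisymm (length_le_of_directSum_eq hp' hs' hi h.symm)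
    (length_le_of_directSum_eq hp hs hi' h)
  have hpp : p = p' := (List.append_inj h hlen).1
  subst hpp
  exact ⟨rfl, directSum_injective_right p h⟩

/-- A separable permutation is irreducible iff it is `1` or its reversal is reducible. -/
theorem separable_and_irreducible_iff {w : List ℕ} :
    Separable w ∧ Irreducible w ↔ w = [1] ∨ Separable w ∧ Reducible w.reverse := by
  constructor
  · rintro ⟨h, -, hi⟩
    cases h with
    | one => exact Or.inl rfl
    | sum hp hs => exact absurd (reducible_directSum hp hs) hi
    | skew hp hs =>
      refine Or.inr ⟨hp.skew hs, ?_⟩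
      rw [reverse_skewSum]
      exact reducible_directSum hs.reverse hp.reverse
  · rintro (rfl | ⟨h, hr⟩)
    · exact ⟨Separable.one, by simp, not_reducible_singleton 1⟩
    · refine ⟨h, h.ne_nil, ?_⟩
      obtain ⟨p, s, hp, -, hs, e⟩ := h.reverse.exists_irreducible_directSum hr
      have := congrArg List.reverse e
      rw [List.reverse_reverse, reverse_directSum] at this
      rw [← this]
      exact not_reducible_skewSum hs.reverse hp.reverse

/-! ### The statistics -/

open scoped Classical in
/-- The number of positions whose entry is related by `r` to every earlier entry. -/
noncomputable def records (r : ℕ → ℕ → Prop) (w : List ℕ) : ℕ :=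
  (Finset.univ.filter fun i : Fin w.length => ∀ j : Fin w.length, j < i → r w[j] w[i]).card

theorem lmax_eq_records (w : List ℕ) : lmax w = records (· < ·) w := by
  unfold lmax records; congr

theorem lmin_eq_records (w : List ℕ) : lmin w = records (· > ·) w := by
  unfold lmin records; congr

open scoped Classical in
theorem records_eq_sum_range (r : ℕ → ℕ → Prop) (w : List ℕ) :
    records r w = ∑ i ∈ Finset.range w.length,
      if ∀ j < i, r (w.getD j 0) (w.getD i 0) then 1 else 0 := by
  rw [records, Finset.card_filter, Finset.sum_range]
  refine Finset.sum_congr rfl fun i _ => ?_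
  congr 1
  refine propext ⟨fun h j hj => ?_, fun h j hj => ?_⟩
  · have := h ⟨j, hj.trans i.2⟩ hj
    rw [List.getD_eq_getElem _ _ (hj.trans i.2), List.getD_eq_getElem _ _ i.2]
    exact this
  · have := h j hj
    rwa [List.getD_eq_getElem _ _ j.2, List.getD_eq_getElem _ _ i.2] at this

open scoped Classical in
theorem records_append (r : ℕ → ℕ → Prop) (u v : List ℕ) :
    records r (u ++ v) = records r u + ∑ i ∈ Finset.range v.length,
      if (∀ a ∈ u, r a (v.getD i 0)) ∧ ∀ j < i, r (v.getD j 0) (v.getD i 0) then 1 else 0 := by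
  rw [records_eq_sum_range, records_eq_sum_range, List.length_append, Finset.sum_range_add]
  congr 1
  · refine Finset.sum_congr rfl fun i hi => ?_
    have hi := Finset.mem_range.1 hi
    congr 1
    refine propext (forall₂_congr fun j hj => ?_)
    rw [List.getD_append _ _ _ _ hi, List.getD_append _ _ _ _ (hj.trans hi)]
  · refine Finset.sum_congr rfl fun i _ => ?_
    congr 1
    rw [List.getD_append_right _ _ _ _ (by omega), Nat.add_sub_cancel_left]
    refine propext ⟨fun h => ⟨fun a ha => ?_, fun j hj => ?_⟩, fun h j hj => ?_⟩
    · obtain ⟨k, hk, rfl⟩ := List.getElem_of_mem ha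
      have := h k (by omega)
      rwa [List.getD_append _ _ _ _ hk, List.getD_eq_getElem _ _ hk] at this
    · have := h (u.length + j) (by omega)
      rwa [List.getD_append_right _ _ _ _ (by omega), Nat.add_sub_cancel_left] at this
    · by_cases hk : j < u.length
      · rw [List.getD_append _ _ _ _ hk, List.getD_eq_getElem _ _ hk]
        exact h.1 _ (List.getElem_mem hk)
      · rw [List.getD_append_right _ _ _ _ (by omega)]
        exact h.2 _ (by omega)

theorem records_append_of_forall {r : ℕ → ℕ → Prop} {u v : List ℕ}
    (h : ∀ a ∈ u, ∀ b ∈ v, r a b) : records r (u ++ v) = records r u + records r v := by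
  classical
  rw [records_append, records_eq_sum_range r v]
  congr 1
  refine Finset.sum_congr rfl fun i hi => ?_
  have hi := Finset.mem_range.1 hi
  congr 1
  refine propext (and_iff_right fun a ha => ?_)
  rw [List.getD_eq_getElem _ _ hi]
  exact h a ha _ (List.getElem_mem hi)

/-- Any one entry of `u` keeps every entry of `v` from being a record, which is why `u` must be
nonempty. -/
theorem records_append_of_forall_not {r : ℕ → ℕ → Prop} {u v : List ℕ} (hu : u ≠ [])
    (h : ∀ a ∈ u, ∀ b ∈ v, ¬ r a b) : records r (u ++ v) = records r u := by
  classical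
  rw [records_append, Nat.add_eq_left]
  refine Finset.sum_eq_zero fun i hi => ?_
  have hi := Finset.mem_range.1 hi
  obtain ⟨a, ha⟩ := List.exists_mem_of_ne_nil u hu
  rw [if_neg]
  intro h'
  have := h'.1 a ha
  rw [List.getD_eq_getElem _ _ hi] at this
  exact h a ha _ (List.getElem_mem hi) this

theorem records_map {r : ℕ → ℕ → Prop} {f : ℕ → ℕ} (hf : ∀ a b, r (f a) (f b) ↔ r a b)
    (w : List ℕ) : records r (w.map f) = records r w := by
  classical
  rw [records_eq_sum_range, records_eq_sum_range, List.length_map]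
  refine Finset.sum_congr rfl fun i hi => ?_
  have hi := Finset.mem_range.1 hi
  congr 1
  refine propext (forall₂_congr fun j hj => ?_)
  have hj := hj.trans hi
  rw [List.getD_eq_getElem _ _ (by simpa), List.getD_eq_getElem _ _ (by simpa),
    List.getD_eq_getElem _ _ hi, List.getD_eq_getElem _ _ hj, List.getElem_map, List.getElem_map,
    hf]

theorem lmax_directSum {p s : List ℕ} (hp : Separable p) (hs : Separable s) :
    lmax (directSum p s) = lmax p + lmax s := by
  simp only [lmax_eq_records, directSum]
  rw [records_append_of_forall, records_map (by simp)]
  simp only [List.mem_map, forall_exists_index, and_imp, forall_apply_eq_imp_iff₂]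
  intro a ha b hb
  have := hp.mem_bounds ha
  have := hs.mem_bounds hb
  omega

theorem lmax_skewSum {p s : List ℕ} (hp : Separable p) (hs : Separable s) :
    lmax (skewSum p s) = lmax p := by
  simp only [lmax_eq_records, skewSum]
  rw [records_append_of_forall_not (by simpa using hp.ne_nil), records_map (by simp)]
  simp only [List.mem_map, forall_exists_index, and_imp, forall_apply_eq_imp_iff₂]
  intro a ha b hb
  have := hp.mem_bounds ha
  have := hs.mem_bounds hb
  omega

theorem lmin_directSum {p s : List ℕ} (hp : Separable p) (hs : Separable s) :
    lmin (directSum p s) = lmin p := by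
  simp only [lmin_eq_records, directSum]
  rw [records_append_of_forall_not hp.ne_nil]
  simp only [List.mem_map, forall_exists_index, and_imp, forall_apply_eq_imp_iff₂]
  intro a ha b hb
  have := hp.mem_bounds ha
  have := hs.mem_bounds hb
  omega

theorem lmin_skewSum {p s : List ℕ} (hp : Separable p) (hs : Separable s) :
    lmin (skewSum p s) = lmin p + lmin s := by
  simp only [lmin_eq_records, skewSum]
  rw [records_append_of_forall, records_map (by simp)]
  simp only [List.mem_map, forall_exists_index, and_imp, forall_apply_eq_imp_iff₂]
  intro a ha b hb
  have := hp.mem_bounds ha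
  have := hs.mem_bounds hb
  omega

theorem lmax_reverse (w : List ℕ) : lmax w.reverse = rmax w := by
  unfold lmax rmax
  refine Finset.card_bij' (fun i _ => Fin.rev (i.cast (by simp)))
    (fun i _ => (Fin.rev i).cast (by simp)) ?_ ?_ (by simp) (by simp)
  · intro i hi
    simp only [Finset.mem_filter, Finset.mem_univ, true_and] at hi ⊢
    intro j hj
    have := hi ((Fin.rev j).cast (by simp)) (by
      simp only [Fin.lt_def, Fin.val_rev, Fin.val_cast] at hj ⊢; omega)
    simp only [Fin.getElem_fin, List.getElem_reverse, Fin.val_rev, Fin.val_cast] at this ⊢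
    convert this using 2 <;> omega
  · intro i hi
    simp only [Finset.mem_filter, Finset.mem_univ, true_and] at hi ⊢
    intro j hj
    have := hi (Fin.rev (j.cast (by simp))) (by
      simp only [Fin.lt_def, Fin.val_rev, Fin.val_cast] at hj ⊢; omega)
    simp only [Fin.getElem_fin, List.getElem_reverse, Fin.val_rev, Fin.val_cast] at this ⊢
    convert this using 2 <;> omega

theorem lmin_reverse (w : List ℕ) : lmin w.reverse = rmin w := by
  unfold lmin rmin
  refine Finset.card_bij' (fun i _ => Fin.rev (i.cast (by simp)))
    (fun i _ => (Fin.rev i).cast (by simp)) ?_ ?_ (by simp) (by simp)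
  · intro i hi
    simp only [Finset.mem_filter, Finset.mem_univ, true_and] at hi ⊢
    intro j hj
    have := hi ((Fin.rev j).cast (by simp)) (by
      simp only [Fin.lt_def, Fin.val_rev, Fin.val_cast] at hj ⊢; omega)
    simp only [Fin.getElem_fin, List.getElem_reverse, Fin.val_rev, Fin.val_cast] at this ⊢
    convert this using 2 <;> omega
  · intro i hi
    simp only [Finset.mem_filter, Finset.mem_univ, true_and] at hi ⊢
    intro j hj
    have := hi (Fin.rev (j.cast (by simp))) (by
      simp only [Fin.lt_def, Fin.val_rev, Fin.val_cast] at hj ⊢; omega)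
    simp only [Fin.getElem_fin, List.getElem_reverse, Fin.val_rev, Fin.val_cast] at this ⊢
    convert this using 2 <;> omega

theorem rmin_directSum {p s : List ℕ} (hp : Separable p) (hs : Separable s) :
    rmin (directSum p s) = rmin p + rmin s := by
  simp only [← lmin_reverse]
  rw [reverse_directSum, lmin_skewSum hs.reverse hp.reverse, add_comm]

theorem rmin_skewSum {p s : List ℕ} (hp : Separable p) (hs : Separable s) :
    rmin (skewSum p s) = rmin s := by
  simp only [← lmin_reverse]
  rw [reverse_skewSum, lmin_directSum hs.reverse hp.reverse]

/-! ### Generating functions -/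

theorem genFun_congr {P Q : List ℕ → Prop} {f g : List ℕ → ℕ} (h : ∀ w, P w ↔ Q w)
    (hf : ∀ w, P w → f w = g w) : genFun P f = genFun Q g := by
  obtain rfl : P = Q := funext fun w => propext (h w)
  ext n : 1
  simp only [genFun, PowerSeries.coeff_mk]
  refine Finset.sum_congr rfl fun w hw => ?_
  simp only [Finset.mem_filter] at hw
  rw [hf w hw.2]

theorem genFun_or {P Q : List ℕ → Prop} (f : List ℕ → ℕ) (h : ∀ w, P w → ¬ Q w) :
    genFun (fun w => P w ∨ Q w) f = genFun P f + genFun Q f := by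
  classical
  ext n : 1
  simp only [genFun, PowerSeries.coeff_mk, map_add, Finset.sum_filter,
    ← Finset.sum_add_distrib]
  refine Finset.sum_congr rfl fun w _ => ?_
  by_cases hP : P w
  · simp [hP, h w hP]
  · simp [hP]

theorem reverse_mem_perms {n : ℕ} {w : List ℕ} : w.reverse ∈ perms n ↔ w ∈ perms n := by
  rw [mem_perms, mem_perms, List.perm_iff_count, List.perm_iff_count]
  simp

theorem genFun_reverse (P : List ℕ → Prop) (f : List ℕ → ℕ) :
    genFun (fun w => P w.reverse) (fun w => f w.reverse) = genFun P f := by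
  ext n : 1
  simp only [genFun, PowerSeries.coeff_mk]
  refine Finset.sum_bij' (fun w _ => w.reverse) (fun w _ => w.reverse) ?_ ?_ (by simp) (by simp)
    (by simp)
  · intro w hw
    simpa [reverse_mem_perms] using hw
  · intro w hw
    simpa [reverse_mem_perms] using hw

theorem Separable.mem_perms_iff {w : List ℕ} (h : Separable w) {n : ℕ} :
    w ∈ perms n ↔ w.length = n := by
  refine ⟨fun h1 => by simpa using (mem_perms.1 h1).length_eq, ?_⟩
  rintro rfl
  exact mem_perms.2 h.perm

theorem genFun_eq_one (f : List ℕ → ℕ) :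
    genFun (fun w => w = [1]) f = zVar ^ f [1] * tVar := by
  classical
  ext n : 1
  simp only [genFun, PowerSeries.coeff_mk, zVar, tVar, ← map_pow, PowerSeries.coeff_C_mul,
    PowerSeries.coeff_X]
  have h1 : [1] ∈ perms n ↔ 1 = n := Separable.one.mem_perms_iff
  rw [Finset.sum_filter]
  split_ifs with hn
  · rw [Finset.sum_eq_single_of_mem [1] (h1.2 hn.symm), if_pos rfl, mul_one]
    intro w _ hw
    rw [if_neg hw]
  · rw [mul_zero]
    refine Finset.sum_eq_zero fun w hw => if_neg ?_
    rintro rfl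
    exact hn (h1.1 hw).symm

theorem constantCoeff_genFun_separable (f : List ℕ → ℕ) :
    PowerSeries.constantCoeff (genFun Separable f) = 0 := by
  rw [← PowerSeries.coeff_zero_eq_constantCoeff_apply, genFun, PowerSeries.coeff_mk]
  refine Finset.sum_eq_zero fun w hw => ?_
  simp only [Finset.mem_filter] at hw
  obtain ⟨h1, h2⟩ := hw
  have := (mem_perms.1 h1).length_eq
  exact absurd (List.length_eq_zero_iff.1 (by simpa using this)) h2.ne_nil

/-- Cutting a reducible separable permutation after its first irreducible component. -/
theorem genFun_reducible {f a b : List ℕ → ℕ}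
    (h : ∀ p s, Separable p → Separable s → f (directSum p s) = a p + b s) :
    genFun (fun w => Separable w ∧ Reducible w) f =
      genFun (fun w => Separable w ∧ Irreducible w) a * genFun Separable b := by
  classical
  ext n : 1
  simp only [PowerSeries.coeff_mul, genFun, PowerSeries.coeff_mk, Finset.sum_mul_sum,
    ← Finset.sum_product']
  rw [Finset.sum_sigma']
  symm
  refine Finset.sum_nbij (fun x => directSum x.2.1 x.2.2) ?_ ?_ ?_ ?_
  · rintro ⟨⟨i, j⟩, p, s⟩ hx
    simp only [Finset.mem_sigma, Finset.HasAntidiagonal.mem_antidiagonal, Finset.mem_product,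
      Finset.mem_filter] at hx ⊢
    obtain ⟨hij, ⟨hp, hps, -⟩, hs, hss⟩ := hx
    rw [hps.mem_perms_iff] at hp
    rw [hss.mem_perms_iff] at hs
    refine ⟨(hps.sum hss).mem_perms_iff.2 ?_, hps.sum hss, reducible_directSum hps hss⟩
    simp [directSum, hp, hs, hij]
  · rintro ⟨⟨i, j⟩, p, s⟩ hx ⟨⟨i', j'⟩, p', s'⟩ hx' heq
    simp only [Finset.mem_coe, Finset.mem_sigma, Finset.HasAntidiagonal.mem_antidiagonal, Finset.mem_product,
      Finset.mem_filter] at hx hx' heq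
    obtain ⟨hij, ⟨hp, hps, hpi⟩, hs, hss⟩ := hx
    obtain ⟨hij', ⟨hp', hps', hpi'⟩, hs', hss'⟩ := hx'
    obtain ⟨rfl, rfl⟩ := directSum_inj_of_irreducible hps hss hps' hss' hpi.2 hpi'.2 heq
    rw [hps.mem_perms_iff] at hp hp'
    rw [hss.mem_perms_iff] at hs hs'
    subst hp hs hp' hs'
    rfl
  · intro w hw
    simp only [Finset.mem_coe, Finset.mem_filter] at hw
    obtain ⟨hw, hws, hwr⟩ := hw
    obtain ⟨p, s, hp, hpi, hs, rfl⟩ := hws.exists_irreducible_directSum hwr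
    refine ⟨⟨(p.length, s.length), p, s⟩, ?_, rfl⟩
    simp only [Finset.mem_coe, Finset.mem_sigma, Finset.HasAntidiagonal.mem_antidiagonal, Finset.mem_product,
      Finset.mem_filter]
    rw [hws.mem_perms_iff] at hw
    exact ⟨by simpa [directSum] using hw, ⟨hp.mem_perms_iff.2 rfl, hp, hpi⟩,
      hs.mem_perms_iff.2 rfl, hs⟩
  · rintro ⟨⟨i, j⟩, p, s⟩ hx
    simp only [Finset.mem_sigma, Finset.HasAntidiagonal.mem_antidiagonal, Finset.mem_product,
      Finset.mem_filter] at hx ⊢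
    rw [h p s hx.2.1.2.1 hx.2.2.2, pow_add]

theorem genFun_separable_eq_add (f : List ℕ → ℕ) :
    genFun Separable f = genFun (fun w => Separable w ∧ Irreducible w) f
      + genFun (fun w => Separable w ∧ Reducible w) f := by
  rw [← genFun_or f (fun w h h' => h.2.2 h'.2)]
  refine genFun_congr (fun w => ?_) fun _ _ => rfl
  refine ⟨fun h => ?_, fun h => h.elim And.left And.left⟩
  by_cases hr : Reducible w
  · exact Or.inr ⟨h, hr⟩
  · exact Or.inl ⟨h, h.ne_nil, hr⟩

theorem genFun_irreducible (f : List ℕ → ℕ) :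
    genFun (fun w => Separable w ∧ Irreducible w) f = genFun (fun w => w = [1]) f
      + genFun (fun w => Separable w ∧ Reducible w) (fun w => f w.reverse) := by
  have h : genFun (fun w => Separable w ∧ Reducible w) (fun w => f w.reverse)
      = genFun (fun w => Separable w ∧ Reducible w.reverse) f := by
    rw [← genFun_reverse]
    exact genFun_congr (fun w => by rw [separable_reverse_iff]) (by simp)
  rw [h, ← genFun_or f]
  · exact genFun_congr (fun w => separable_and_irreducible_iff) fun _ _ => rfl
  · rintro w rfl h
    exact not_reducible_singleton 1 h.2

theorem genFun_separable_reverse (f : List ℕ → ℕ) :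
    genFun Separable (fun w => f w.reverse) = genFun Separable f := by
  rw [← genFun_reverse Separable f]
  exact genFun_congr (fun w => separable_reverse_iff.symm) fun _ _ => rfl

/-- The generating function of the separable permutations by length. -/
noncomputable def sepSer : Ser := genFun Separable fun _ => 0

/-- The generating function of the irreducible separable permutations by length. -/
noncomputable def irrSer : Ser := genFun (fun w => Separable w ∧ Irreducible w) fun _ => 0

/-- The zero statistic is additive, so the decomposition lemmas specialise to counting by length. -/
theorem sepSer_eq : sepSer = irrSer * (1 + sepSer) := by
  have h := genFun_separable_eq_add fun _ => 0
  rw [genFun_reducible (a := fun _ => 0) (b := fun _ => 0) (by simp)] at h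
  simp only [sepSer, irrSer]
  linear_combination h

theorem irrSer_eq : irrSer = tVar + irrSer * sepSer := by
  have h := genFun_irreducible fun _ => 0
  rw [genFun_eq_one, pow_zero, one_mul, genFun_reducible (a := fun _ => 0) (b := fun _ => 0) (by simp)] at h
  exact h

/-- The statistics `lmax` and `rmin`: additive over `⊕`, and read off one of the two summands
on `⊖`. -/
structure SumAdditive (f : List ℕ → ℕ) : Prop where
  one : f [1] = 1
  sum : ∀ p s, Separable p → Separable s → f (directSum p s) = f p + f s
  skew : (∀ p s, Separable p → Separable s → f (skewSum p s) = f p) ∨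
    ∀ p s, Separable p → Separable s → f (skewSum p s) = f s

theorem sumAdditive_lmax : SumAdditive lmax :=
  ⟨by decide, fun _ _ => lmax_directSum, Or.inl fun _ _ => lmax_skewSum⟩

theorem sumAdditive_rmin : SumAdditive rmin :=
  ⟨by decide, fun _ _ => rmin_directSum, Or.inr fun _ _ => rmin_skewSum⟩

theorem one_add_ne_zero {f : Ser} (hf : PowerSeries.constantCoeff f = 0) : 1 + f ≠ 0 := by
  intro h
  have := congrArg PowerSeries.constantCoeff h
  simp [hf] at this

theorem SumAdditive.reducible {f : List ℕ → ℕ} (hf : SumAdditive f) :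
    genFun (fun w => Separable w ∧ Reducible w) f =
      genFun (fun w => Separable w ∧ Irreducible w) f * genFun Separable f :=
  genFun_reducible hf.sum

theorem SumAdditive.irreducible_mul {f : List ℕ → ℕ} (hf : SumAdditive f) :
    genFun (fun w => Separable w ∧ Irreducible w) f * (1 + genFun Separable f)
      = genFun Separable f := by
  have h := genFun_separable_eq_add f
  rw [hf.reducible] at h
  linear_combination -h

/-- Reversing `p ⊕ s` gives a skew sum, where `f` sees only one summand. If it sees the reversal of
`s`, the irreducible `p` contributes only its length, and the product is immediate. -/
theorem SumAdditive.reducible_reverse {f : List ℕ → ℕ} (hf : SumAdditive f) :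
    genFun (fun w => Separable w ∧ Reducible w) (fun w => f w.reverse)
      = irrSer * genFun Separable f := by
  rcases hf.skew with h | h
  · rw [genFun_reducible (a := fun _ => 0) (b := fun w => f w.reverse), genFun_separable_reverse,
      irrSer]
    intro p s hp hs
    rw [reverse_directSum, h _ _ hs.reverse hp.reverse, zero_add]
  -- Here the statistic sits on the irreducible factor instead. With `R'`, `I'` for the reversed
  -- statistic and `B` for `sepSer`, `R' = I' B` and `S = I' + R'` give `R' (1 + B) = S B`; then `B
  -- = A (1 + B)` allows cancelling `1 + B`.
  · have h1 := genFun_reducible (f := fun w => f w.reverse) (a := fun w => f w.reverse)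
      (b := fun _ => 0) (by
        intro p s hp hs
        rw [reverse_directSum, h _ _ hs.reverse hp.reverse, add_zero])
    have h2 := genFun_separable_eq_add fun w => f w.reverse
    rw [genFun_separable_reverse] at h2
    change _ = _ * sepSer at h1
    apply mul_right_cancel₀ (one_add_ne_zero (constantCoeff_genFun_separable fun _ => 0))
    change _ * (1 + sepSer) = _ * (1 + sepSer)
    linear_combination h1 - sepSer * h2 + genFun Separable f * sepSer_eq

theorem SumAdditive.irreducible {f : List ℕ → ℕ} (hf : SumAdditive f) :
    genFun (fun w => Separable w ∧ Irreducible w) f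
      = zVar * tVar + irrSer * genFun Separable f := by
  rw [genFun_irreducible, genFun_eq_one, hf.one, pow_one, hf.reducible_reverse]

/-! ### Solving the quadratic equations -/

/-- The root of a square selected by its constant term. -/
theorem eq_of_sq_eq_sq_of_constantCoeff {f g : Ser} (h : f ^ 2 = g ^ 2)
    (hf : PowerSeries.constantCoeff f = 1) (hg : PowerSeries.constantCoeff g = 1) : f = g := by
  rcases sq_eq_sq_iff_eq_or_eq_neg.1 h with h | h
  · exact h
  · have := congrArg PowerSeries.constantCoeff h
    rw [map_neg, hf, hg] at this
    -- Evaluation moves the contradiction `1 = -1` from `ℚ[z]` to `ℚ`.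
    have := congrArg (Polynomial.eval 0) this
    norm_num at this

/-- Eliminating `A` from `B = A (1 + B)` and `A = t + A B` gives `B² + (t - 1) B + t = 0`, whose
discriminant is the inner radicand. -/
theorem innerRoot_eq_sub_sepSer : innerRoot = 1 - tVar - 2 * sepSer := by
  refine eq_of_sq_eq_sq_of_constantCoeff ?_ innerRoot_spec.2 ?_
  · rw [innerRoot_spec.1]
    linear_combination (4 - 4 * sepSer) * sepSer_eq + (4 + 4 * sepSer) * irrSer_eq
  · have : PowerSeries.constantCoeff sepSer = 0 := constantCoeff_genFun_separable _
    simp [this, tVar]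

/-- The two equations give `B - A = A B = A - t`, hence `B = 2A - t`. -/
theorem innerRoot_eq : innerRoot = 1 + tVar - 4 * irrSer := by
  rw [innerRoot_eq_sub_sepSer]
  linear_combination -2 * sepSer_eq + 2 * irrSer_eq

theorem constantCoeff_irrSer : PowerSeries.constantCoeff irrSer = 0 := by
  have h : PowerSeries.constantCoeff sepSer = 0 := constantCoeff_genFun_separable _
  rw [irrSer_eq]
  simp [h, tVar]

theorem irrSer_ne_zero : irrSer ≠ 0 := by
  intro h
  have := irrSer_eq
  rw [h, zero_mul, add_zero] at this
  exact PowerSeries.X_ne_zero this.symm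

theorem outerRoot_sq :
    outerRoot ^ 2 = (1 + irrSer - tVar * zVar) ^ 2 - 4 * irrSer := by
  have h : -(1 / 4 : ℚ) • innerRoot - tVar * zVar + (1 / 4 : ℚ) • tVar + (5 / 4 : ℚ) • (1 : Ser)
      = 1 + irrSer - tVar * zVar := by
    have h4 : (4 : Ser) * irrSer = (4 : ℚ) • irrSer := by
      rw [ofNat_smul_eq_nsmul]; simp
    rw [innerRoot_eq, h4]
    module
  rw [outerRoot_spec.1, h, innerRoot_eq]
  ring

/-- Completing the square in the quadratic for `S` over `A`: the right side squares to the
discriminant and has constant term `1`. -/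
theorem SumAdditive.outerRoot_eq {f : List ℕ → ℕ} (hf : SumAdditive f) :
    outerRoot = 1 - irrSer - zVar * tVar - 2 * irrSer * genFun Separable f := by
  refine eq_of_sq_eq_sq_of_constantCoeff ?_ outerRoot_spec.2 ?_
  · rw [outerRoot_sq]
    have h := hf.irreducible_mul
    rw [hf.irreducible] at h
    linear_combination -4 * irrSer * h
  · simp [constantCoeff_irrSer, tVar]

theorem SumAdditive.toFrac_genFun {f : List ℕ → ℕ} (hf : SumAdditive f) :
    toFrac (genFun Separable f) =
        (4 * toFrac outerRoot - toFrac innerRoot + 4 * toFrac tVar * toFrac zVar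
            + toFrac tVar - 3) /
          (2 * (toFrac innerRoot - toFrac tVar - 1)) := by
  have h0 : toFrac irrSer ≠ 0 := by
    simpa using irrSer_ne_zero
  have h1 : toFrac innerRoot = 1 + toFrac tVar - 4 * toFrac irrSer := by
    rw [innerRoot_eq]; simp only [map_add, map_sub, map_mul, map_one, map_ofNat]
  have h2 : toFrac outerRoot = 1 - toFrac irrSer - toFrac zVar * toFrac tVar
      - 2 * toFrac irrSer * toFrac (genFun Separable f) := by
    rw [hf.outerRoot_eq]; simp only [map_sub, map_mul, map_one, map_ofNat]
  have h8 : (8 : Frac) ≠ 0 := by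
    have : toFrac 8 ≠ 0 := by
      rw [Ne, map_eq_zero_iff _ (IsFractionRing.injective Ser Frac)]
      intro h
      have := congrArg (fun g => Polynomial.eval 0 (PowerSeries.constantCoeff g)) h
      rw [map_ofNat, map_zero] at this
      norm_num at this
    rwa [map_ofNat] at this
  -- After substitution the numerator is `-8 A S` and the denominator `-8 A`, so only `8 ≠ 0` and `A
  -- ≠ 0` are needed.
  rw [eq_div_iff, h1, h2]
  · ring
  · rw [h1, show 2 * (1 + toFrac tVar - 4 * toFrac irrSer - toFrac tVar - 1)
      = -(8 * toFrac irrSer) by ring]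
    exact neg_ne_zero.2 (mul_ne_zero h8 h0)

theorem toFrac_one_add_genFun_ne_zero (f : List ℕ → ℕ) :
    1 + toFrac (genFun Separable f) ≠ 0 := by
  rw [← map_one toFrac, ← map_add, Ne, map_eq_zero_iff _ (IsFractionRing.injective Ser Frac)]
  exact one_add_ne_zero (constantCoeff_genFun_separable f)

theorem SumAdditive.toFrac_irreducible {f : List ℕ → ℕ} (hf : SumAdditive f) :
    toFrac (genFun (fun w => Separable w ∧ Irreducible w) f) =
        toFrac (genFun Separable f) / (1 + toFrac (genFun Separable f)) := by
  rw [eq_div_iff (toFrac_one_add_genFun_ne_zero f)]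
  simpa using congrArg toFrac hf.irreducible_mul

theorem SumAdditive.toFrac_reducible {f : List ℕ → ℕ} (hf : SumAdditive f) :
    toFrac (genFun (fun w => Separable w ∧ Reducible w) f) =
        toFrac (genFun Separable f) ^ 2 / (1 + toFrac (genFun Separable f)) := by
  rw [hf.reducible, map_mul, hf.toFrac_irreducible]
  ring

theorem SumAdditive.toFrac_reducible_reverse {f : List ℕ → ℕ} (hf : SumAdditive f) :
    toFrac (genFun (fun w => Separable w ∧ Reducible w) (fun w => f w.reverse)) =
        toFrac (genFun Separable f) / (1 + toFrac (genFun Separable f))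
          - toFrac zVar * toFrac tVar := by
  rw [hf.reducible_reverse, ← hf.toFrac_irreducible, hf.irreducible]
  simp

/-- This is the complement of the reducible part, since reversal leaves the total `S` unchanged, and
`S - S / (1 + S) = S² / (1 + S)`. -/
theorem SumAdditive.toFrac_irreducible_reverse {f : List ℕ → ℕ} (hf : SumAdditive f) :
    toFrac (genFun (fun w => Separable w ∧ Irreducible w) (fun w => f w.reverse)) =
        toFrac (genFun Separable f) ^ 2 / (1 + toFrac (genFun Separable f))
          + toFrac zVar * toFrac tVar := by
  have h := congrArg toFrac (genFun_separable_eq_add fun w => f w.reverse)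
  rw [genFun_separable_reverse, map_add, hf.toFrac_reducible_reverse] at h
  rw [← sub_eq_iff_eq_add.2 h]
  have := toFrac_one_add_genFun_ne_zero f
  field_simp
  ring

theorem rmax_eq_lmax_reverse : rmax = fun w => lmax w.reverse :=
  funext fun w => (lmax_reverse w).symm

theorem lmin_eq_rmin_reverse : lmin = fun w => rmin w.reverse :=
  funext fun w => by rw [← lmin_reverse, List.reverse_reverse]

end SepPerm

theorem theorem3 :
    (∀ stat ∈ ({lmax, rmax, lmin, rmin} : Set (List ℕ → ℕ)),
      toFrac (genFun Separable stat) =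
        (4 * toFrac outerRoot - toFrac innerRoot + 4 * toFrac tVar * toFrac zVar
            + toFrac tVar - 3) /
          (2 * (toFrac innerRoot - toFrac tVar - 1))) ∧
    (∀ stat ∈ ({rmax, lmin} : Set (List ℕ → ℕ)),
      toFrac (genFun (fun w => Separable w ∧ SepPerm.Irreducible w) stat) =
        toFrac (genFun Separable stat) ^ 2 / (1 + toFrac (genFun Separable stat))
          + toFrac zVar * toFrac tVar ∧
      toFrac (genFun (fun w => Separable w ∧ Reducible w) stat) =
        toFrac (genFun Separable stat) / (1 + toFrac (genFun Separable stat))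
          - toFrac zVar * toFrac tVar) ∧
    (∀ stat ∈ ({lmax, rmin} : Set (List ℕ → ℕ)),
      toFrac (genFun (fun w => Separable w ∧ SepPerm.Irreducible w) stat) =
        toFrac (genFun Separable stat) / (1 + toFrac (genFun Separable stat)) ∧
      toFrac (genFun (fun w => Separable w ∧ Reducible w) stat) =
        toFrac (genFun Separable stat) ^ 2 / (1 + toFrac (genFun Separable stat))) := by
  refine ⟨?_, ?_, ?_⟩
  · rintro stat (rfl | rfl | rfl | rfl)
    · exact sumAdditive_lmax.toFrac_genFun
    · rw [rmax_eq_lmax_reverse, genFun_separable_reverse]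
      exact sumAdditive_lmax.toFrac_genFun
    · rw [lmin_eq_rmin_reverse, genFun_separable_reverse]
      exact sumAdditive_rmin.toFrac_genFun
    · exact sumAdditive_rmin.toFrac_genFun
  · rintro stat (rfl | rfl)
    · rw [rmax_eq_lmax_reverse, genFun_separable_reverse]
      exact ⟨sumAdditive_lmax.toFrac_irreducible_reverse,
        sumAdditive_lmax.toFrac_reducible_reverse⟩
    · rw [lmin_eq_rmin_reverse, genFun_separable_reverse]
      exact ⟨sumAdditive_rmin.toFrac_irreducible_reverse,
        sumAdditive_rmin.toFrac_reducible_reverse⟩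
  · rintro stat (rfl | rfl)
    · exact ⟨sumAdditive_lmax.toFrac_irreducible, sumAdditive_lmax.toFrac_reducible⟩
    · exact ⟨sumAdditive_rmin.toFrac_irreducible, sumAdditive_rmin.toFrac_reducible⟩
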